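/- Let $L>0$, let $\mathbb{T}_3=\mathbb{R}^3/L\mathbb{Z}^3$ be the periodic box of side $L$ with Lebesgue measure, and let $\mathcal{T}_3=\frac{2\pi}{L}\mathbb{Z}^3$ be its lattice of wave vectors. For a square integrable field $\mathbf{w}=\sum_{\mathbf{k}\in\mathcal{T}_3}\widehat{\mathbf{w}}_{\mathbf{k}}e^{i\mathbf{k}\cdot\mathbf{x}}:\mathbb{T}_3\to\mathbb{C}^3$ and $s\ge 0$ put $$\|\mathbf{w}\|_s=\Big(L^3\sum_{\mathbf{k}\neq 0}|\mathbf{k}|^{2s}|\widehat{\mathbf{w}}_{\mathbf{k}}|^2\Big)^{1/2}\in[0,\infty],$$ let $\mathbb{H}_s$ be the space of such fields with $\widehat{\mathbf{w}}_0=0$ and $\|\mathbf{w}\|_s<\infty$, and let $\mathbf{H}_s\subset\mathbb{H}_s$ be the subspace of the real valued, divergence free ones (for all $\mathbf{k}$, $\widehat{\mathbf{w}}_{\mathbf{k}}^{\star}=\widehat{\mathbf{w}}_{-\mathbf{k}}$ and $\mathbf{k}\cdot\widehat{\mathbf{w}}_{\mathbf{k}}=0$). On zero-mean fields $\|\cdot\|_0$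 is the $L^2(\mathbb{T}_3)$ norm; for the tensor field $\boldsymbol{\tau}_N$ below, $\|\cdot\|_0$ denotes the $L^2(\mathbb{T}_3)$ norm (with the Frobenius norm of matrices). For $s\in\{\frac12,1\}$ let $S_s$ be the Sobolev constant of the injection $\mathbb{H}_s\hookrightarrow L^{s^\star}(\mathbb{T}_3)^3$, $\frac1{s^\star}=\frac12-\frac s3$ (so $1^\star=6$ and $(\frac12)^\star=3$), i.e. the least $S\in[0,\infty]$ such that $\|\mathbf{w}\|_{L^{s^\star}}^2\le S\,\|\mathbf{w}\|_s^2$ for all $\mathbf{w}\in\mathbb{H}_s$. For $\alpha>0$ and $p\ge 3/4$ let $G$ be the generalised Helmholtz filter, $\widehat{(G\mathbf{w})}_{\mathbf{k}}=(1+\alpha^{2p}|\mathbf{k}|^{2p})^{-1}\,\widehat{\mathbf{w}}_{\mathbf{k}}$ for $\mathbf{k}\ne0$, and $\widehat{(G\mathbf{w})}_0=0$; for $N\in\mathbb{N}=\{0,1,2,\dots\}$ let $D_N=\sum_{n=0}^{N}(I-G)^n$. For a velocity field $\mathbf{u}$ write $\overline{\mathbf{u}}=G\mathbf{u}$, and let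 $$\boldsymbol{\tau}_N=\mathbf{u}\otimes\mathbf{u}-D_N\overline{\mathbf{u}}\otimes D_N\overline{\mathbf{u}}$$ be the residual stress. **Corollary.** The Sobolev constants $S_1$ and $S_{1/2}$ are positive, finite and do not depend on $L$. With the universal constant $C=S_1S_{1/2}$, for all $L>0$, $\alpha>0$, $p\ge 3/4$, $N\in\mathbb{N}$, $T\in\mathbb{R}$ and every $\mathbf{u}:[0,T]\to\mathbf{H}_0$, $$\|\boldsymbol{\tau}_N(t,\cdot)\|_0^2\;\le\;\frac{2C\alpha}{(2p(N+1))^{1/(2p)}}\;\|\mathbf{u}(t,\cdot)\|_1^4\qquad\text{for all } t\in[0,T],$$ where the right-hand side is $+\infty$ if $\mathbf{u}(t,\cdot)\notin\mathbf{H}_1$. -/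

import Mathlib

open MeasureTheory
open scoped ENNReal ComplexConjugate

noncomputable section

namespace ResidualStress

/-- The three-dimensional torus. A field on the box of side `L` (the torus `ℝ³ / Lℤ³`) is
represented in the rescaled coordinate `y = x / L`, so `y` runs over `(ℝ / ℤ)³`. -/
abbrev Torus : Type := UnitAddTorus (Fin 3)

/-- The Haar probability measure on `(ℝ / ℤ)³`. -/
abbrev haar : Measure Torus := Measure.pi fun _ : Fin 3 => AddCircle.haarAddCircle

/-- Lebesgue measure of the box of side `L`, in the rescaled coordinate (total mass `L ^ 3`). -/
def boxMeasure (L : ℝ) : Measure Torus := ENNReal.ofReal (L ^ 3) • haar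

/-- Square integrable complex scalar functions on the torus. -/
abbrev Scalar : Type := Lp ℂ 2 haar

/-- Square integrable vector fields `w = (w₁, w₂, w₃)` on the torus. -/
abbrev Field : Type := Fin 3 → Scalar

/-- The wave vector `k = 2πn / L`; the character `exp (i k·x)` is `exp (2πi n·y)` in `y = x / L`. -/
def waveVector (L : ℝ) (n : Fin 3 → ℤ) : EuclideanSpace ℝ (Fin 3) :=
  WithLp.toLp 2 fun i => 2 * Real.pi / L * (n i : ℝ)

/-- The Fourier coefficient `ŵ_k ∈ ℂ³`, `k = 2πn / L`, of a vector field. -/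
def coeff (w : Field) (n : Fin 3 → ℤ) : EuclideanSpace ℂ (Fin 3) :=
  WithLp.toLp 2 fun i => UnitAddTorus.mFourierCoeff (w i) n

/-- The norm `‖w‖_s = (L³ ∑_{k ≠ 0} |k|^{2s} |ŵ_k|²)^{1/2}`, with value `∞` if the sum diverges.
The volume factor makes `‖w‖₀` the norm of `L²` of the box. -/
def sobolevNorm (L s : ℝ) (w : Field) : ℝ≥0∞ :=
  (ENNReal.ofReal (L ^ 3) * ∑' n : {n : Fin 3 → ℤ // n ≠ 0},
    ENNReal.ofReal (‖waveVector L n‖ ^ (2 * s) * ‖coeff w n‖ ^ 2)) ^ (1 / 2 : ℝ)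

/-- The space `ℍ_s`, `s ≥ 0`, of complex fields with zero mean and finite norm `‖·‖_s`. -/
def sobolevSpace (L s : ℝ) : Set Field :=
  {w | coeff w 0 = 0 ∧ sobolevNorm L s w < ∞}

/-- The space `𝐇_s`, `s ≥ 0`, of real valued, divergence free fields in `ℍ_s`. -/
def solenoidalSpace (L s : ℝ) : Set Field :=
  {w | w ∈ sobolevSpace L s ∧ ∀ n : Fin 3 → ℤ,
    (∀ i, conj (coeff w n i) = coeff w (-n) i) ∧
      ∑ i, (waveVector L n i : ℂ) * coeff w n i = 0}

/-- The norm of a vector field in `L^q` of the box. -/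
def lebesgueNorm (L : ℝ) (q : ℝ≥0∞) (w : Field) : ℝ≥0∞ :=
  eLpNorm (fun y => (WithLp.toLp 2 fun i => w i y : EuclideanSpace ℂ (Fin 3))) q (boxMeasure L)

/-- The (best) Sobolev constant `S_s` of the injection `ℍ_s ↪ (L^{s⋆})³`, `1/s⋆ = 1/2 - s/3`:
the least `S` with `‖w‖²_{L^{s⋆}} ≤ S ‖w‖_s²` for all `w ∈ ℍ_s`. -/
def sobolevConst (L s : ℝ) : ℝ≥0∞ :=
  sInf {S : ℝ≥0∞ | ∀ w ∈ sobolevSpace L s,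
    lebesgueNorm L (ENNReal.ofReal (6 / (3 - 2 * s))) w ^ 2 ≤ S * sobolevNorm L s w ^ 2}

/-- The operator on `L²` that multiplies the `n`-th Fourier coefficient by `m n`, `|m n| ≤ 1`. -/
def multiplier (m : (Fin 3 → ℤ) → ℝ) (hm : ∀ n, |m n| ≤ 1) : Scalar →L[ℂ] Scalar :=
  let b := UnitAddTorus.mFourierBasis (d := Fin 3)
  have key : ∀ (f : lp (fun _ : Fin 3 → ℤ => ℂ) 2) (n : Fin 3 → ℤ),
      ‖(m n : ℂ) * f n‖ ≤ ‖f n‖ := fun f n => by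
    rw [norm_mul, Complex.norm_real]
    exact mul_le_of_le_one_left (norm_nonneg _) (hm n)
  have mem : ∀ f : lp (fun _ : Fin 3 → ℤ => ℂ) 2,
      Memℓp (fun n => (m n : ℂ) * f n) 2 := fun f => by
    have h := lp.memℓp f
    rw [memℓp_gen_iff (by norm_num)] at h ⊢
    refine Summable.of_nonneg_of_le (fun n => by positivity) (fun n => ?_) h
    exact Real.rpow_le_rpow (norm_nonneg _) (key f n) (by norm_num)
  LinearMap.mkContinuous
    { toFun := fun f => b.repr.symm ⟨fun n => (m n : ℂ) * b.repr f n, mem (b.repr f)⟩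
      map_add' := fun f g => by
        rw [← map_add]
        congr 1
        ext n
        simp [mul_add]
        rfl
      map_smul' := fun c f => by
        rw [← map_smul]
        congr 1
        ext n
        simp [mul_left_comm] }
    1 fun f => by
      rw [one_mul]
      change ‖b.repr.symm _‖ ≤ _
      rw [LinearIsometryEquiv.norm_map, ← LinearIsometryEquiv.norm_map b.repr f]
      exact lp.norm_mono (by norm_num) fun n => key _ n

/-- The symbol `Ĝ_k = 1 / (1 + α^{2p} |k|^{2p})`, `k ≠ 0`, of the generalised Helmholtz filter
(the kernel has no mean mode, all fields having zero mean). -/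
def helmholtzSymbol (L α p : ℝ) (n : Fin 3 → ℤ) : ℝ :=
  if n = 0 then 0 else 1 / (1 + α ^ (2 * p) * ‖waveVector L n‖ ^ (2 * p))

theorem abs_helmholtzSymbol_le (L p : ℝ) {α : ℝ} (hα : 0 < α) (n : Fin 3 → ℤ) :
    |helmholtzSymbol L α p n| ≤ 1 := by
  unfold helmholtzSymbol
  split_ifs
  · simp
  · have h : 0 ≤ α ^ (2 * p) * ‖waveVector L n‖ ^ (2 * p) := by positivity
    rw [abs_of_nonneg (by positivity)]
    exact div_le_one_of_le₀ (by linarith) (by linarith)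

/-- The generalised Helmholtz filter `G = G_{α,p}`. -/
def filterOp (L p : ℝ) {α : ℝ} (hα : 0 < α) : Scalar →L[ℂ] Scalar :=
  multiplier (helmholtzSymbol L α p) (abs_helmholtzSymbol_le L p hα)

/-- The deconvolution operator `D_N = ∑_{0 ≤ j ≤ N} (I - G)^j`. -/
def deconvolution (L p : ℝ) {α : ℝ} (hα : 0 < α) (N : ℕ) : Scalar →L[ℂ] Scalar :=
  ∑ j ∈ Finset.range (N + 1), (1 - filterOp L p hα) ^ j

/-- The residual stress `τ_N = u ⊗ u - D_N ū ⊗ D_N ū`, where `ū = G u`; the space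
`EuclideanSpace ℂ (Fin 3 × Fin 3)` is that of `3 × 3` matrices with the Frobenius norm. -/
def residualStress (L p : ℝ) {α : ℝ} (hα : 0 < α) (N : ℕ) (u : Field) (y : Torus) :
    EuclideanSpace ℂ (Fin 3 × Fin 3) :=
  let v : Field := fun i => deconvolution L p hα N (filterOp L p hα (u i))
  WithLp.toLp 2 fun ij => u ij.1 y * u ij.2 y - v ij.1 y * v ij.2 y

end ResidualStress

end

/-! With `v = D_N G u`, polarisation gives `u ⊗ u - v ⊗ v = a ⊗ w + w ⊗ a`, where `a = (u + v) / 2`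
and `w = u - v`. Hölder with `1/6 + 1/3 = 1/2` and the two Sobolev inequalities give `‖τ‖₀² ≤ 4 S₁
S_{1/2} ‖a‖₁² ‖w‖_{1/2}²`.

On each mode `w` is `θ u` and `a` is `(1 - θ/2) u`, with `θ = (1 - Ĝ)^(N+1) ∈ [0, 1]` because the
sum defining `D_N` is geometric. Weighted AM-GM gives `θ ≤ K |k|` with `K = α / (2p(N+1))^(1/(2p))`
(`defectSymbol_le`). Bounding `a` and `w` separately would leave the factor 4. Instead
`sobolevNorm_mean_add_defect_le` bounds `‖a‖₁² + K⁻¹ ‖w‖_{1/2}²` by `(5/4) ‖u‖₁²`, since a large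
defect makes the mean small; AM-GM on the two summands then gives `4 · 25/64 = 25/16 ≤ 2`.

Both sides of the Sobolev inequality scale by `L^(3-2s)`, so its constant is independent of `L`.
Finiteness comes from splitting frequencies at a height-dependent cut-off: at height `t` the low
modes are at most `t/2` pointwise by Cauchy-Schwarz, the high modes are handled by Chebyshev in
`L²`, and integration over `t` returns the weight `‖n‖^(2s)` on each mode
(`lintegral_enorm_rpow_le`). A plane wave shows positivity. -/

noncomputable section

namespace ResidualStress

/-! ### Lattice sums -/

/-- The nonzero lattice points of the cube `[-M, M]³`. -/
def puncturedCube (M : ℕ) : Finset (Fin 3 → ℤ) :=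
  (Finset.Icc (fun _ => -(M : ℤ)) (fun _ => (M : ℤ))).erase 0

theorem mem_puncturedCube {M : ℕ} {n : Fin 3 → ℤ} :
    n ∈ puncturedCube M ↔ n ≠ 0 ∧ ‖n‖ ≤ M := by
  rw [puncturedCube, Finset.mem_erase, Finset.mem_Icc, pi_norm_le_iff_of_nonneg (by positivity)]
  refine and_congr_right fun _ => ?_
  simp only [Pi.le_def, ← forall_and, Int.norm_eq_abs, abs_le]
  refine forall_congr' fun i => ?_
  exact_mod_cast Iff.rfl

theorem card_puncturedCube (M : ℕ) : (puncturedCube M).card = (2 * M + 1) ^ 3 - 1 := by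
  rw [puncturedCube, Finset.card_erase_of_mem (by simp [Pi.le_def]), Pi.card_Icc]
  have : ((M : ℤ) + 1 + (M : ℤ)).toNat = 2 * M + 1 := by omega
  simp [this]

theorem norm_int_lattice_succ_le {M : ℕ} {n : Fin 3 → ℤ} (h0 : n ≠ 0)
    (h : n ∉ puncturedCube M) : (M : ℝ) + 1 ≤ ‖n‖ := by
  by_contra! hlt
  refine h (mem_puncturedCube.2 ⟨h0, ?_⟩)
  rw [pi_norm_lt_iff (by positivity)] at hlt
  rw [pi_norm_le_iff_of_nonneg (by positivity)]
  intro i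
  have := hlt i
  rw [Int.norm_eq_abs] at this ⊢
  have h2 : |n i| < (M : ℤ) + 1 := by exact_mod_cast this
  have h3 : |n i| ≤ (M : ℤ) := by omega
  exact_mod_cast h3

/-- Induction over sup-norm shells: the shell of radius `M + 1` has `24M² + 48M + 26 ≤ 26(M+1)²`
points, all with the same weight. -/
theorem sum_puncturedCube_le {s : ℝ} (hs1 : s ≤ 1) (M : ℕ) :
    ∑ n ∈ puncturedCube M, ‖n‖ ^ (-(2 * s)) ≤ 26 * (M : ℝ) ^ (3 - 2 * s) := by
  induction M with
  | zero =>
    have : puncturedCube 0 = ∅ := by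
      rw [← Finset.card_eq_zero, card_puncturedCube]; simp
    rw [this, Finset.sum_empty]
    positivity
  | succ M ih =>
    have hsub : puncturedCube M ⊆ puncturedCube (M + 1) := fun n hn => by
      rw [mem_puncturedCube] at hn ⊢
      refine ⟨hn.1, hn.2.trans ?_⟩
      push_cast; linarith
    rw [← Finset.sum_sdiff hsub]
    have hM : (0 : ℝ) < (M : ℝ) + 1 := by positivity
    have hshell : ∑ n ∈ puncturedCube (M + 1) \ puncturedCube M, ‖n‖ ^ (-(2 * s)) ≤
        26 * ((M : ℝ) + 1) ^ (2 - 2 * s) := by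
      have hconst : ∀ n ∈ puncturedCube (M + 1) \ puncturedCube M,
          ‖n‖ ^ (-(2 * s)) = ((M : ℝ) + 1) ^ (-(2 * s)) := fun n hn => by
        rw [Finset.mem_sdiff] at hn
        have h1 := mem_puncturedCube.1 hn.1
        have h2 := norm_int_lattice_succ_le h1.1 hn.2
        have h3 := h1.2
        push_cast at h3
        rw [le_antisymm h3 h2]
      rw [Finset.sum_congr rfl hconst, Finset.sum_const, Finset.card_sdiff_of_subset hsub,
        card_puncturedCube, card_puncturedCube, nsmul_eq_mul]
      have hcard : (((2 * (M + 1) + 1) ^ 3 - 1 - ((2 * M + 1) ^ 3 - 1) : ℕ) : ℝ) ≤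
          26 * ((M : ℝ) + 1) ^ 2 := by
        have : (2 * (M + 1) + 1) ^ 3 - 1 - ((2 * M + 1) ^ 3 - 1) ≤ 26 * (M + 1) ^ 2 := by
          have e : (2 * (M + 1) + 1) ^ 3 = (2 * M + 1) ^ 3 + (24 * M ^ 2 + 48 * M + 26) := by ring
          have e2 : 26 * (M + 1) ^ 2 = 26 * M ^ 2 + 52 * M + 26 := by ring
          omega
        exact_mod_cast this
      calc _ ≤ 26 * ((M : ℝ) + 1) ^ 2 * ((M : ℝ) + 1) ^ (-(2 * s)) := by gcongr
        _ = _ := by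
          rw [mul_assoc, ← Real.rpow_natCast, ← Real.rpow_add hM]
          norm_num [sub_eq_add_neg]
    -- The new shell fits under the bound because `M^(3-2s) + (M+1)^(2-2s) ≤ (M+1)^(3-2s)`; this
    -- uses `2 - 2s ≥ 0`.
    have hstep : (M : ℝ) ^ (3 - 2 * s) ≤ M * ((M : ℝ) + 1) ^ (2 - 2 * s) := by
      rcases Nat.eq_zero_or_pos M with rfl | hpos
      · rw [Nat.cast_zero, Real.zero_rpow (by linarith)]; simp
      · have hpos' : (0 : ℝ) < M := by exact_mod_cast hpos
        rw [show 3 - 2 * s = 1 + (2 - 2 * s) by ring, Real.rpow_add hpos', Real.rpow_one]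
        have : (M : ℝ) ^ (2 - 2 * s) ≤ ((M : ℝ) + 1) ^ (2 - 2 * s) :=
          Real.rpow_le_rpow hpos'.le (by linarith) (by linarith)
        gcongr
    have hexp : ((M : ℝ) + 1) ^ (3 - 2 * s) = ((M : ℝ) + 1) * ((M : ℝ) + 1) ^ (2 - 2 * s) := by
      rw [show 3 - 2 * s = 1 + (2 - 2 * s) by ring, Real.rpow_add hM, Real.rpow_one]
    push_cast
    rw [hexp]
    linarith

/-! ### Fourier coefficients -/

theorem mFourierCoeff_eq_repr (f : Scalar) (n : Fin 3 → ℤ) :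
    UnitAddTorus.mFourierCoeff f n = UnitAddTorus.mFourierBasis.repr f n :=
  (UnitAddTorus.mFourierBasis_repr f n).symm

theorem mFourierCoeff_add (f g : Scalar) (n : Fin 3 → ℤ) :
    UnitAddTorus.mFourierCoeff (f + g : Scalar) n =
      UnitAddTorus.mFourierCoeff f n + UnitAddTorus.mFourierCoeff g n := by
  simp only [mFourierCoeff_eq_repr]
  exact congrArg (fun h : lp (fun _ : Fin 3 → ℤ => ℂ) 2 => h n)
    (UnitAddTorus.mFourierBasis.repr.map_add f g)

theorem mFourierCoeff_sub (f g : Scalar) (n : Fin 3 → ℤ) :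
    UnitAddTorus.mFourierCoeff (f - g : Scalar) n =
      UnitAddTorus.mFourierCoeff f n - UnitAddTorus.mFourierCoeff g n := by
  simp only [mFourierCoeff_eq_repr]
  exact congrArg (fun h : lp (fun _ : Fin 3 → ℤ => ℂ) 2 => h n)
    (UnitAddTorus.mFourierBasis.repr.map_sub f g)

theorem mFourierCoeff_smul (c : ℂ) (f : Scalar) (n : Fin 3 → ℤ) :
    UnitAddTorus.mFourierCoeff (c • f : Scalar) n = c * UnitAddTorus.mFourierCoeff f n := by
  simp only [mFourierCoeff_eq_repr]
  exact congrArg (fun h : lp (fun _ : Fin 3 → ℤ => ℂ) 2 => h n)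
    (UnitAddTorus.mFourierBasis.repr.map_smul c f)

theorem mFourierCoeff_multiplier (m : (Fin 3 → ℤ) → ℝ) (hm : ∀ n, |m n| ≤ 1) (f : Scalar)
    (n : Fin 3 → ℤ) :
    UnitAddTorus.mFourierCoeff (multiplier m hm f) n = m n * UnitAddTorus.mFourierCoeff f n := by
  simp only [mFourierCoeff_eq_repr]
  simp [multiplier]

theorem ofReal_norm_sq_eq_tsum (f : Scalar) :
    ENNReal.ofReal (‖f‖ ^ 2) =
      ∑' n, ENNReal.ofReal (‖UnitAddTorus.mFourierCoeff f n‖ ^ 2) := by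
  have h : HasSum (fun n => ‖UnitAddTorus.mFourierCoeff f n‖ ^ 2) (‖f‖ ^ 2) := by
    have h1 := UnitAddTorus.hasSum_sq_mFourierCoeff f
    have h2 : ‖f‖ ^ 2 = ∫ t, ‖f t‖ ^ 2 ∂haar := by
      rw [← inner_self_eq_norm_sq (𝕜 := ℂ), L2.inner_def, ← integral_re (L2.integrable_inner f f)]
      simp only [inner_self_eq_norm_sq]
    rw [h2]
    exact h1
  rw [← h.tsum_eq, ENNReal.ofReal_tsum_of_nonneg (fun _ => by positivity) h.summable]

theorem eq_zero_of_mFourierCoeff_eq_zero {f : Scalar}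
    (h : ∀ n, UnitAddTorus.mFourierCoeff f n = 0) : f = 0 := by
  have := ofReal_norm_sq_eq_tsum f
  simp only [h, norm_zero] at this
  simpa using this

/-- The trigonometric polynomial with the Fourier coefficients of `f` on `F`. -/
def trigPoly (f : Scalar) (F : Finset (Fin 3 → ℤ)) : Scalar :=
  ∑ n ∈ F, UnitAddTorus.mFourierCoeff f n • UnitAddTorus.mFourierLp 2 n

theorem mFourierCoeff_trigPoly (f : Scalar) (F : Finset (Fin 3 → ℤ)) (n : Fin 3 → ℤ) :
    UnitAddTorus.mFourierCoeff (trigPoly f F) n =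
      if n ∈ F then UnitAddTorus.mFourierCoeff f n else 0 := by
  rw [mFourierCoeff_eq_repr, HilbertBasis.repr_apply_apply, UnitAddTorus.coe_mFourierBasis]
  have h := (UnitAddTorus.orthonormal_mFourier (d := Fin 3)).inner_right_sum
  split_ifs with hn
  · exact h (fun n => UnitAddTorus.mFourierCoeff f n) hn
  · refine (inner_sum _ _ _).trans (Finset.sum_eq_zero fun m hm => ?_)
    refine (inner_smul_right _ _ _).trans ?_
    have hne : n ≠ m := fun h => hn (h.symm ▸ hm)
    exact mul_eq_zero_of_right _ (UnitAddTorus.orthonormal_mFourier.2 hne)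

theorem norm_trigPoly_le (f : Scalar) (F : Finset (Fin 3 → ℤ)) :
    ∀ᵐ y ∂haar, ‖trigPoly f F y‖ ≤ ∑ n ∈ F, ‖UnitAddTorus.mFourierCoeff f n‖ := by
  induction F using Finset.induction_on with
  | empty =>
    filter_upwards [Lp.coeFn_zero ℂ 2 haar] with y hy
    simp only [trigPoly, Finset.sum_empty]
    rw [hy]
    simp
  | insert a F ha ih =>
    have hsplit : trigPoly f (insert a F) =
        UnitAddTorus.mFourierCoeff f a • UnitAddTorus.mFourierLp 2 a + trigPoly f F :=
      Finset.sum_insert ha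
    rw [hsplit]
    have h1 : ∀ᵐ y ∂haar, UnitAddTorus.mFourierLp 2 a y = UnitAddTorus.mFourier a y :=
      UnitAddTorus.coeFn_mFourierLp 2 a
    have h2 : ∀ᵐ y ∂haar,
        (UnitAddTorus.mFourierCoeff f a • UnitAddTorus.mFourierLp 2 a : Scalar) y =
        UnitAddTorus.mFourierCoeff f a • (UnitAddTorus.mFourierLp 2 a : Scalar) y :=
      Lp.coeFn_smul _ _
    filter_upwards [ih, h1, h2, Lp.coeFn_add (UnitAddTorus.mFourierCoeff f a •
      UnitAddTorus.mFourierLp 2 a : Scalar) (trigPoly f F)] with y h h1 h2 h3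
    rw [h3, Pi.add_apply, h2, h1, Finset.sum_insert ha]
    refine (norm_add_le _ _).trans (add_le_add ?_ h)
    rw [norm_smul]
    refine mul_le_of_le_one_right (norm_nonneg _) ?_
    exact ((UnitAddTorus.mFourier a).norm_coe_le_norm y).trans UnitAddTorus.mFourier_norm.le

/-! ### The Sobolev inequality -/

/-- Weak-type estimate: the level set `{|f| > t}` is controlled by the modes outside of a cube
over which the sum of the moduli of the coefficients is at most `t / 2`. -/
theorem measure_norm_gt_le (f : Scalar) (F : Finset (Fin 3 → ℤ)) {t : ℝ} (ht : 0 < t)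
    (hF : ∑ n ∈ F, ‖UnitAddTorus.mFourierCoeff f n‖ ≤ t / 2) :
    haar {y | t < ‖f y‖} ≤ ENNReal.ofReal (4 / t ^ 2) *
      ∑' n, if n ∈ F then 0 else ENNReal.ofReal (‖UnitAddTorus.mFourierCoeff f n‖ ^ 2) := by
  set g : Scalar := f - trigPoly f F with hg
  -- The polynomial part is at most `t / 2`, so the remainder must carry the other half of the
  -- height; Chebyshev then applies to it.
  have hsub : ∀ᵐ y ∂haar, t < ‖f y‖ → ENNReal.ofReal (t / 2) ≤ ‖g y‖ₑ := by
    filter_upwards [norm_trigPoly_le f F, Lp.coeFn_sub f (trigPoly f F)] with y h1 h2 h3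
    rw [← ofReal_norm, hg, h2, Pi.sub_apply]
    refine ENNReal.ofReal_le_ofReal ?_
    have := norm_sub_norm_le (f y) (trigPoly f F y)
    linarith
  have hcheb := mul_meas_ge_le_pow_eLpNorm' haar (p := 2) (by norm_num) (by norm_num)
    (Lp.aestronglyMeasurable g) (ENNReal.ofReal (t / 2))
  have hnorm : eLpNorm g 2 haar ^ (2 : ℝ≥0∞).toReal =
      ∑' n, if n ∈ F then 0 else ENNReal.ofReal (‖UnitAddTorus.mFourierCoeff f n‖ ^ 2) := by
    have h1 : eLpNorm g 2 haar = ENNReal.ofReal ‖g‖ := by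
      rw [Lp.norm_def, ENNReal.ofReal_toReal (Lp.eLpNorm_ne_top g)]
    rw [h1, ENNReal.toReal_ofNat, ENNReal.rpow_ofNat, ← ENNReal.ofReal_pow (norm_nonneg _),
      ofReal_norm_sq_eq_tsum]
    refine tsum_congr fun n => ?_
    rw [hg, mFourierCoeff_sub, mFourierCoeff_trigPoly]
    split_ifs <;> simp
  rw [hnorm] at hcheb
  have hpow : ENNReal.ofReal (t / 2) ^ (2 : ℝ≥0∞).toReal = (ENNReal.ofReal (4 / t ^ 2))⁻¹ := by
    rw [ENNReal.toReal_ofNat, ENNReal.rpow_ofNat, ← ENNReal.ofReal_pow (by positivity),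
      ← ENNReal.ofReal_inv_of_pos (by positivity)]
    congr 1
    field_simp
    norm_num
  have h4 : ENNReal.ofReal (4 / t ^ 2) ≠ 0 := by
    rw [Ne, ENNReal.ofReal_eq_zero, not_le]; positivity
  rw [hpow, ENNReal.inv_mul_le_iff h4 ENNReal.ofReal_ne_top] at hcheb
  refine le_trans (measure_mono_ae ?_) hcheb
  filter_upwards [hsub] with y hy using hy

/-- Cauchy-Schwarz with the weights `‖n‖^(-2s)` and `‖n‖^(2s)`. -/
theorem sum_norm_mFourierCoeff_le {s : ℝ} (hs1 : s ≤ 1) (f : Scalar) {E : ℝ} (hE : 0 ≤ E)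
    (hf : ∑' n : Fin 3 → ℤ, ENNReal.ofReal (‖n‖ ^ (2 * s) *
      ‖UnitAddTorus.mFourierCoeff f n‖ ^ 2) ≤ ENNReal.ofReal E) (M : ℕ) :
    ∑ n ∈ puncturedCube M, ‖UnitAddTorus.mFourierCoeff f n‖ ≤
      Real.sqrt (26 * (M : ℝ) ^ (3 - 2 * s) * E) := by
  refine Real.le_sqrt_of_sq_le ?_
  have hfin : ∑ n ∈ puncturedCube M, ‖n‖ ^ (2 * s) * ‖UnitAddTorus.mFourierCoeff f n‖ ^ 2 ≤ E := by
    rw [← ENNReal.ofReal_le_ofReal_iff hE, ENNReal.ofReal_sum_of_nonneg fun n _ => by positivity]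
    exact (ENNReal.sum_le_tsum _).trans hf
  have hCS := Finset.sum_sq_le_sum_mul_sum_of_sq_le_mul (puncturedCube M)
    (r := fun n => ‖UnitAddTorus.mFourierCoeff f n‖)
    (f := fun n => ‖n‖ ^ (-(2 * s)))
    (g := fun n => ‖n‖ ^ (2 * s) * ‖UnitAddTorus.mFourierCoeff f n‖ ^ 2)
    (fun n _ => by positivity) (fun n _ => by positivity) (fun n hn => by
      have : 0 < ‖n‖ := norm_pos_iff.2 (mem_puncturedCube.1 hn).1
      rw [← mul_assoc, ← Real.rpow_add this, neg_add_cancel, Real.rpow_zero, one_mul])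
  refine hCS.trans (mul_le_mul (sum_puncturedCube_le hs1 M) hfin ?_ (by positivity))
  exact Finset.sum_nonneg fun n _ => by positivity

theorem lintegral_Ioo_rpow {b r : ℝ} (hb : 0 ≤ b) (hr : -1 < r) :
    ∫⁻ t in Set.Ioo 0 b, ENNReal.ofReal (t ^ r) = ENNReal.ofReal (b ^ (r + 1) / (r + 1)) := by
  have hint : IntegrableOn (fun t : ℝ => t ^ r) (Set.Ioo 0 b) := by
    rw [← integrableOn_Ioc_iff_integrableOn_Ioo, ← intervalIntegrable_iff_integrableOn_Ioc_of_le hb]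
    exact intervalIntegral.intervalIntegrable_rpow' hr
  rw [← ofReal_integral_eq_lintegral_ofReal hint, ← integral_Ioc_eq_integral_Ioo,
    ← intervalIntegral.integral_of_le hb, integral_rpow (Or.inl hr),
    Real.zero_rpow (by linarith), sub_zero]
  exact (ae_restrict_iff' measurableSet_Ioo).2 (.of_forall fun t ht => Real.rpow_nonneg ht.1.le _)

/-- The cut-off amplitude of the mode `n`: the modes with amplitude at most `t` have coefficients
with sum of moduli at most `t / 2`. -/
def amplitude (s E : ℝ) (n : Fin 3 → ℤ) : ℝ :=
  2 * Real.sqrt (26 * E) * ‖n‖ ^ ((3 - 2 * s) / 2)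

/-- The cube in `measure_norm_gt_le` is chosen in terms of `t`. Recasting "`n` lies outside the
cube" as "`t` lies below the amplitude of `n`" prepares the exchange of the sum over modes with the
integral over `t`. -/
theorem measure_norm_gt_le_tsum_amplitude {s : ℝ} (hs1 : s ≤ 1) (f : Scalar)
    (hf0 : UnitAddTorus.mFourierCoeff f 0 = 0) {E : ℝ} (hE : 0 < E)
    (hf : ∑' n : Fin 3 → ℤ, ENNReal.ofReal (‖n‖ ^ (2 * s) *
      ‖UnitAddTorus.mFourierCoeff f n‖ ^ 2) ≤ ENNReal.ofReal E) {t : ℝ} (ht : 0 < t) :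
    haar {y | t < ‖f y‖} ≤ ∑' n, ENNReal.ofReal (‖UnitAddTorus.mFourierCoeff f n‖ ^ 2) *
      (Set.Iio (amplitude s E n)).indicator (fun t => ENNReal.ofReal (4 / t ^ 2)) t := by
  have hr : 0 < 3 - 2 * s := by linarith
  set c : ℝ := 2 * Real.sqrt (26 * E) with hc
  have hc0 : 0 < c := by positivity
  -- The radius at which the Cauchy-Schwarz bound `√(26 A^(3-2s) E)` equals `t / 2`.
  set A : ℝ := (t / c) ^ (2 / (3 - 2 * s)) with hA
  have hA0 : 0 ≤ A := by positivity
  have hAp : A ^ ((3 - 2 * s) / 2) = t / c := by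
    rw [hA, ← Real.rpow_mul (by positivity)]
    rw [show 2 / (3 - 2 * s) * ((3 - 2 * s) / 2) = 1 by field_simp, Real.rpow_one]
  set M : ℕ := ⌊A⌋₊ with hM
  have hMA : (M : ℝ) ≤ A := Nat.floor_le hA0
  have hlow : ∑ n ∈ puncturedCube M, ‖UnitAddTorus.mFourierCoeff f n‖ ≤ t / 2 := by
    refine (sum_norm_mFourierCoeff_le hs1 f hE.le hf M).trans ?_
    have h1 : (M : ℝ) ^ (3 - 2 * s) ≤ (t / c) ^ 2 := by
      calc (M : ℝ) ^ (3 - 2 * s) ≤ A ^ (3 - 2 * s) := Real.rpow_le_rpow (by positivity) hMA hr.le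
        _ = (t / c) ^ 2 := by
          rw [← hAp, ← Real.rpow_natCast, ← Real.rpow_mul hA0]
          norm_num
    calc Real.sqrt (26 * (M : ℝ) ^ (3 - 2 * s) * E)
        ≤ Real.sqrt ((26 * E) * (t / c) ^ 2) := by
          refine Real.sqrt_le_sqrt ?_
          nlinarith
      _ = Real.sqrt (26 * E) * (t / c) := by
          rw [Real.sqrt_mul (by positivity), Real.sqrt_sq (by positivity)]
      _ = t / 2 := by
          rw [hc]; field_simp
  refine (measure_norm_gt_le f _ ht hlow).trans ?_
  rw [← ENNReal.tsum_mul_left]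
  refine ENNReal.tsum_le_tsum fun n => ?_
  by_cases hn : n ∈ puncturedCube M
  · simp [hn]
  rw [if_neg hn]
  rcases eq_or_ne n 0 with rfl | hn0
  · simp [hf0]
  -- Integrality: outside the cube of radius `⌊A⌋` the sup norm is at least `⌊A⌋ + 1`, which exceeds
  -- `A`.
  have hAn : A < ‖n‖ := (Nat.lt_floor_add_one A).trans_le (norm_int_lattice_succ_le hn0 hn)
  have hlt : t < amplitude s E n := by
    have : t / c < ‖n‖ ^ ((3 - 2 * s) / 2) := by
      rw [← hAp]
      exact Real.rpow_lt_rpow hA0 hAn (by linarith)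
    rw [div_lt_iff₀' hc0] at this
    exact this
  rw [Set.indicator_of_mem (Set.mem_Iio.2 hlt), mul_comm]

/-- The Sobolev inequality for mean free functions on the torus. -/
theorem lintegral_enorm_rpow_le {s q : ℝ} (hs0 : 0 < s) (hs1 : s ≤ 1) (hq : q = 6 / (3 - 2 * s))
    (f : Scalar) (hf0 : UnitAddTorus.mFourierCoeff f 0 = 0) {E : ℝ} (hE : 0 < E)
    (hf : ∑' n : Fin 3 → ℤ, ENNReal.ofReal (‖n‖ ^ (2 * s) *
      ‖UnitAddTorus.mFourierCoeff f n‖ ^ 2) ≤ ENNReal.ofReal E) :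
    ∫⁻ y, ‖f y‖ₑ ^ q ∂haar ≤
      ENNReal.ofReal (q * (4 * (2 * Real.sqrt (26 * E)) ^ (q - 2) / (q - 2)) * E) := by
  have hr : 0 < 3 - 2 * s := by linarith
  have hq2 : q - 2 = 4 * s / (3 - 2 * s) := by rw [hq]; field_simp; ring
  have hq2pos : 0 < q - 2 := by rw [hq2]; positivity
  have hlayer := lintegral_rpow_eq_lintegral_meas_lt_mul haar (f := fun y => ‖f y‖)
    (.of_forall fun y => norm_nonneg _) (Lp.aestronglyMeasurable f).norm.aemeasurable
    (p := q) (by linarith)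
  have hlhs : ∫⁻ y, ‖f y‖ₑ ^ q ∂haar = ∫⁻ y, ENNReal.ofReal (‖f y‖ ^ q) ∂haar :=
    lintegral_congr fun y => by
      rw [← ofReal_norm, ENNReal.ofReal_rpow_of_nonneg (norm_nonneg _) (by linarith)]
  -- One mode contributes `4 ∫ t^(q-3) dt` up to its amplitude. The integral converges at `0` since
  -- `q > 2`, and the exponents match because `(3-2s)/2 · (q-2) = 2s`.
  have hmode : ∀ n : Fin 3 → ℤ, ∫⁻ t in Set.Ioi 0,
      (Set.Iio (amplitude s E n)).indicator (fun t => ENNReal.ofReal (4 / t ^ 2)) t *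
        ENNReal.ofReal (t ^ (q - 1)) =
      ENNReal.ofReal (4 * (2 * Real.sqrt (26 * E)) ^ (q - 2) / (q - 2) * ‖n‖ ^ (2 * s)) := by
    intro n
    have hamp : 0 ≤ amplitude s E n := by unfold amplitude; positivity
    have h1 : ∀ t ∈ Set.Ioi (0 : ℝ),
        (Set.Iio (amplitude s E n)).indicator (fun t => ENNReal.ofReal (4 / t ^ 2)) t *
          ENNReal.ofReal (t ^ (q - 1)) =
        (Set.Iio (amplitude s E n)).indicator
          (fun t => ENNReal.ofReal 4 * ENNReal.ofReal (t ^ (q - 3))) t := by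
      intro t ht
      have ht : 0 < t := ht
      by_cases hmem : t ∈ Set.Iio (amplitude s E n)
      · rw [Set.indicator_of_mem hmem, Set.indicator_of_mem hmem,
          ← ENNReal.ofReal_mul (by positivity), ← ENNReal.ofReal_mul (by positivity)]
        congr 1
        rw [show q - 1 = (q - 3) + 2 by ring, Real.rpow_add ht, Real.rpow_ofNat]
        field_simp
      · rw [Set.indicator_of_notMem hmem, Set.indicator_of_notMem hmem, zero_mul]
    rw [setLIntegral_congr_fun measurableSet_Ioi h1, setLIntegral_indicator measurableSet_Iio,
      Set.inter_comm, Set.Ioi_inter_Iio, lintegral_const_mul' _ _ ENNReal.ofReal_ne_top,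
      lintegral_Ioo_rpow hamp (by linarith), ← ENNReal.ofReal_mul (by norm_num)]
    congr 1
    rw [show q - 3 + 1 = q - 2 by ring, amplitude, Real.mul_rpow (by positivity) (by positivity),
      ← Real.rpow_mul (norm_nonneg _)]
    have : (3 - 2 * s) / 2 * (q - 2) = 2 * s := by rw [hq2]; field_simp; ring
    rw [this]
    ring
  rw [hlhs, hlayer]
  calc ENNReal.ofReal q * ∫⁻ t in Set.Ioi 0, haar {y | t < ‖f y‖} * ENNReal.ofReal (t ^ (q - 1))
      ≤ ENNReal.ofReal q * ∫⁻ t in Set.Ioi 0, ∑' n : Fin 3 → ℤ,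
          ENNReal.ofReal (‖UnitAddTorus.mFourierCoeff f n‖ ^ 2) *
          ((Set.Iio (amplitude s E n)).indicator (fun t => ENNReal.ofReal (4 / t ^ 2)) t *
            ENNReal.ofReal (t ^ (q - 1))) := by
        gcongr ENNReal.ofReal q * ?_
        refine setLIntegral_mono' measurableSet_Ioi fun t ht => ?_
        simp_rw [← mul_assoc, ENNReal.tsum_mul_right]
        gcongr
        exact measure_norm_gt_le_tsum_amplitude hs1 f hf0 hE hf ht
    _ = ENNReal.ofReal q * ∑' n : Fin 3 → ℤ,
          ENNReal.ofReal (‖UnitAddTorus.mFourierCoeff f n‖ ^ 2) *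
          ENNReal.ofReal (4 * (2 * Real.sqrt (26 * E)) ^ (q - 2) / (q - 2) * ‖n‖ ^ (2 * s)) := by
        have hmeas : ∀ n : Fin 3 → ℤ, Measurable fun t : ℝ =>
            (Set.Iio (amplitude s E n)).indicator (fun t => ENNReal.ofReal (4 / t ^ 2)) t *
            ENNReal.ofReal (t ^ (q - 1)) := fun n =>
          ((by fun_prop : Measurable fun t : ℝ => ENNReal.ofReal (4 / t ^ 2)).indicator
            measurableSet_Iio).mul (by fun_prop)
        rw [lintegral_tsum fun n => ((hmeas n).const_mul _).aemeasurable]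
        simp_rw [lintegral_const_mul _ (hmeas _), hmode]
    _ = ENNReal.ofReal q * (ENNReal.ofReal (4 * (2 * Real.sqrt (26 * E)) ^ (q - 2) / (q - 2)) *
          ∑' n : Fin 3 → ℤ, ENNReal.ofReal (‖n‖ ^ (2 * s) *
            ‖UnitAddTorus.mFourierCoeff f n‖ ^ 2)) := by
        rw [← ENNReal.tsum_mul_left
          (a := ENNReal.ofReal (4 * (2 * Real.sqrt (26 * E)) ^ (q - 2) / (q - 2)))]
        refine congrArg _ (tsum_congr fun n => ?_)
        rw [← ENNReal.ofReal_mul (by positivity), ← ENNReal.ofReal_mul (by positivity)]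
        congr 1
        ring
    _ ≤ ENNReal.ofReal q * (ENNReal.ofReal (4 * (2 * Real.sqrt (26 * E)) ^ (q - 2) / (q - 2)) *
          ENNReal.ofReal E) := by gcongr
    _ = _ := by
        rw [← ENNReal.ofReal_mul (by positivity), ← ENNReal.ofReal_mul (by linarith)]
        congr 1
        ring

/-- The constant in `eLpNorm_sq_le`. -/
def scalarConst (q : ℝ) : ℝ :=
  (q * (4 * (2 * Real.sqrt 26) ^ (q - 2) / (q - 2))) ^ (2 / q)

/-- The integral bound is a constant times `E^((q-2)/2) · E = E^(q/2)`, so the power `2/q` makes it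
linear in `E`. Zero and infinite energy are separated because that bound needs a finite `E > 0`. -/
theorem eLpNorm_sq_le {s q : ℝ} (hs0 : 0 < s) (hs1 : s ≤ 1) (hq : q = 6 / (3 - 2 * s))
    (f : Scalar) (hf0 : UnitAddTorus.mFourierCoeff f 0 = 0) :
    eLpNorm f (ENNReal.ofReal q) haar ^ 2 ≤ ENNReal.ofReal (scalarConst q) *
      ∑' n : Fin 3 → ℤ, ENNReal.ofReal (‖n‖ ^ (2 * s) *
        ‖UnitAddTorus.mFourierCoeff f n‖ ^ 2) := by
  have hr : 0 < 3 - 2 * s := by linarith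
  have hq2 : q - 2 = 4 * s / (3 - 2 * s) := by rw [hq]; field_simp; ring
  have hq2pos : 0 < q - 2 := by rw [hq2]; positivity
  have hq0 : 0 < q := by linarith
  have hconst : 0 < scalarConst q := by unfold scalarConst; positivity
  set X := ∑' n : Fin 3 → ℤ, ENNReal.ofReal (‖n‖ ^ (2 * s) *
        ‖UnitAddTorus.mFourierCoeff f n‖ ^ 2) with hX
  rcases eq_or_ne X ∞ with htop | htop
  · rw [htop, ENNReal.mul_top (by simpa using hconst)]
    exact le_top
  rcases eq_or_ne X 0 with hzero | hzero
  · have hf : f = 0 := eq_zero_of_mFourierCoeff_eq_zero fun n => by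
      rcases eq_or_ne n 0 with rfl | hn
      · exact hf0
      rw [hX, ENNReal.tsum_eq_zero] at hzero
      have h1 := ENNReal.ofReal_eq_zero.1 (hzero n)
      have h2 : 0 < ‖n‖ ^ (2 * s) := Real.rpow_pos_of_pos (norm_pos_iff.2 hn) _
      have h3 := nonpos_of_mul_nonpos_right h1 h2
      simpa using le_antisymm h3 (by positivity)
    have : eLpNorm f (ENNReal.ofReal q) haar = 0 := by
      rw [hf, eLpNorm_congr_ae (Lp.coeFn_zero ℂ 2 haar), eLpNorm_zero]
    rw [this]
    simp
  have hE : 0 < X.toReal := ENNReal.toReal_pos hzero htop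
  have hXE : X = ENNReal.ofReal X.toReal := (ENNReal.ofReal_toReal htop).symm
  set E := X.toReal with hEdef
  have hmain := lintegral_enorm_rpow_le hs0 hs1 hq f hf0 hE hXE.le
  have hqt : (ENNReal.ofReal q).toReal = q := ENNReal.toReal_ofReal hq0.le
  rw [eLpNorm_eq_lintegral_rpow_enorm_toReal (by simpa using hq0) ENNReal.ofReal_ne_top, hqt,
    ← ENNReal.rpow_natCast, ← ENNReal.rpow_mul]
  refine (ENNReal.rpow_le_rpow hmain (by positivity)).trans ?_
  rw [hXE, ENNReal.ofReal_rpow_of_nonneg (by positivity) (by positivity),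
    ← ENNReal.ofReal_mul hconst.le]
  refine ENNReal.ofReal_le_ofReal (le_of_eq ?_)
  rw [Real.sqrt_mul (by norm_num), ← mul_assoc 2,
    Real.mul_rpow (x := 2 * Real.sqrt 26) (by positivity) (by positivity)]
  have hEpow : Real.sqrt E ^ (q - 2) * E = E ^ (q / 2) := by
    rw [Real.sqrt_eq_rpow, ← Real.rpow_mul hE.le]
    nth_rewrite 2 [← Real.rpow_one E]
    rw [← Real.rpow_add hE]
    congr 1
    ring
  have hre : q * (4 * ((2 * Real.sqrt 26) ^ (q - 2) * Real.sqrt E ^ (q - 2)) / (q - 2)) * E =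
      q * (4 * (2 * Real.sqrt 26) ^ (q - 2) / (q - 2)) * E ^ (q / 2) := by
    rw [← hEpow]; ring
  rw [hre, Real.mul_rpow (by positivity) (by positivity), ← Real.rpow_mul hE.le, scalarConst]
  have e1 : 1 / q * ((2 : ℕ) : ℝ) = 2 / q := by push_cast; ring
  have e2 : q / 2 * (2 / q) = 1 := by field_simp
  rw [e1, e2, Real.rpow_one]

/-! ### The Sobolev constants -/

theorem norm_waveVector (L : ℝ) (n : Fin 3 → ℤ) :
    ‖waveVector L n‖ = |L|⁻¹ * ‖waveVector 1 n‖ := by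
  have : waveVector L n = L⁻¹ • waveVector 1 n := by
    ext i
    simp only [waveVector, PiLp.smul_apply, smul_eq_mul]
    ring
  rw [this, norm_smul, norm_inv, Real.norm_eq_abs]

/-- Passes from the sup norm used for the cubes to the Euclidean wave vector; nothing is lost in the
constant as `2π ≥ 1`. -/
theorem norm_le_norm_waveVector_one (n : Fin 3 → ℤ) : ‖n‖ ≤ ‖waveVector 1 n‖ := by
  rw [pi_norm_le_iff_of_nonneg (norm_nonneg _)]
  intro i
  refine le_trans ?_ (PiLp.norm_apply_le (waveVector 1 n) i)
  simp only [waveVector, div_one, norm_mul, Real.norm_eq_abs, Int.norm_eq_abs]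
  rw [abs_of_pos Real.pi_pos, abs_two]
  have := Real.pi_gt_three
  nlinarith [abs_nonneg (n i : ℝ)]

theorem norm_waveVector_pos {L : ℝ} (hL : 0 < L) {n : Fin 3 → ℤ} (hn : n ≠ 0) :
    0 < ‖waveVector L n‖ := by
  rw [norm_waveVector, abs_of_pos hL]
  have : 0 < ‖n‖ := norm_pos_iff.2 hn
  have := norm_le_norm_waveVector_one n
  have : 0 < ‖waveVector 1 n‖ := by linarith
  positivity

theorem sobolevNorm_sq (L s : ℝ) (w : Field) :
    sobolevNorm L s w ^ 2 = ENNReal.ofReal (L ^ 3) * ∑' n : {n : Fin 3 → ℤ // n ≠ 0},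
      ENNReal.ofReal (‖waveVector L n‖ ^ (2 * s) * ‖coeff w n‖ ^ 2) := by
  rw [sobolevNorm, ← ENNReal.rpow_natCast, ← ENNReal.rpow_mul]
  norm_num

theorem sobolevNorm_sq_eq_scale {L : ℝ} (hL : 0 < L) (s : ℝ) (w : Field) :
    sobolevNorm L s w ^ 2 = ENNReal.ofReal (L ^ (3 - 2 * s)) * sobolevNorm 1 s w ^ 2 := by
  rw [sobolevNorm_sq, sobolevNorm_sq, one_pow, ENNReal.ofReal_one, one_mul,
    ← ENNReal.tsum_mul_left, ← ENNReal.tsum_mul_left]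
  refine tsum_congr fun n => ?_
  rw [← ENNReal.ofReal_mul (by positivity), ← ENNReal.ofReal_mul (by positivity)]
  congr 1
  rw [norm_waveVector L, abs_of_pos hL, Real.mul_rpow (by positivity) (norm_nonneg _),
    Real.inv_rpow hL.le, Real.rpow_sub hL]
  norm_cast
  ring

theorem boxMeasure_one : boxMeasure 1 = haar := by simp [boxMeasure]

/-- The volume factor enters as `(L³)^(2/q)` with `6/q = 3 - 2s`: the same power of `L` as in
`sobolevNorm_sq_eq_scale`, so the two cancel in the Sobolev inequality. -/
theorem lebesgueNorm_sq_eq_scale {L : ℝ} (hL : 0 < L) {s : ℝ} (hs1 : s ≤ 1) (w : Field) :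
    lebesgueNorm L (ENNReal.ofReal (6 / (3 - 2 * s))) w ^ 2 = ENNReal.ofReal (L ^ (3 - 2 * s)) *
      lebesgueNorm 1 (ENNReal.ofReal (6 / (3 - 2 * s))) w ^ 2 := by
  have hr : 0 < 3 - 2 * s := by linarith
  rw [lebesgueNorm, lebesgueNorm, boxMeasure_one, boxMeasure,
    eLpNorm_smul_measure_of_ne_top ENNReal.ofReal_ne_top, smul_eq_mul, mul_pow]
  congr 1
  rw [one_div, ENNReal.toReal_inv, ENNReal.toReal_ofReal (by positivity),
    ENNReal.ofReal_rpow_of_nonneg (by positivity) (by positivity),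
    ← ENNReal.ofReal_pow (by positivity), ← Real.rpow_natCast, ← Real.rpow_natCast,
    ← Real.rpow_mul hL.le, ← Real.rpow_mul hL.le]
  congr 2
  push_cast
  field_simp
  norm_num

theorem mem_sobolevSpace_iff {L : ℝ} (hL : 0 < L) {s : ℝ} {w : Field} :
    w ∈ sobolevSpace L s ↔ w ∈ sobolevSpace 1 s := by
  have hsq : ∀ x : ℝ≥0∞, x < ∞ ↔ x ^ 2 < ∞ := fun x => by simp [lt_top_iff_ne_top]
  have h0 : ENNReal.ofReal (L ^ (3 - 2 * s)) ≠ 0 := by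
    rw [Ne, ENNReal.ofReal_eq_zero, not_le]; positivity
  simp only [sobolevSpace, Set.mem_ofPred_eq]
  rw [hsq (sobolevNorm L s w), sobolevNorm_sq_eq_scale hL, hsq (sobolevNorm 1 s w)]
  simp [lt_top_iff_ne_top, ENNReal.mul_eq_top, h0]

theorem sobolevConst_eq_one {L : ℝ} (hL : 0 < L) {s : ℝ} (hs1 : s ≤ 1) :
    sobolevConst L s = sobolevConst 1 s := by
  have h0 : ENNReal.ofReal (L ^ (3 - 2 * s)) ≠ 0 := by
    rw [Ne, ENNReal.ofReal_eq_zero, not_le]; positivity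
  unfold sobolevConst
  congr 1
  ext S
  refine forall_congr' fun w => ?_
  rw [mem_sobolevSpace_iff hL, lebesgueNorm_sq_eq_scale hL hs1, sobolevNorm_sq_eq_scale hL,
    mul_left_comm, ENNReal.mul_le_mul_iff_right h0 ENNReal.ofReal_ne_top]

theorem aestronglyMeasurable_field (w : Field) (μ : Measure Torus) (hμ : μ ≪ haar) :
    AEStronglyMeasurable
      (fun y => (WithLp.toLp 2 fun i => w i y : EuclideanSpace ℂ (Fin 3))) μ := by
  refine AEStronglyMeasurable.mono_ac hμ ?_
  have h : AEStronglyMeasurable (fun y => fun i => w i y) haar :=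
    (aemeasurable_pi_lambda _ fun i => (Lp.aestronglyMeasurable (w i)).aemeasurable)
      |>.aestronglyMeasurable
  exact (PiLp.continuous_toLp 2 _).comp_aestronglyMeasurable h

theorem boxMeasure_absolutelyContinuous (L : ℝ) : boxMeasure L ≪ haar :=
  Measure.smul_absolutelyContinuous

theorem tsum_component_le {s : ℝ} (hs0 : 0 < s) (w : Field) (i : Fin 3) :
    ∑' n : Fin 3 → ℤ, ENNReal.ofReal (‖n‖ ^ (2 * s) *
      ‖UnitAddTorus.mFourierCoeff (w i) n‖ ^ 2) ≤ sobolevNorm 1 s w ^ 2 := by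
  -- The zero mode drops out of the full sum because `0^(2s) = 0` for `s > 0`.
  have hsupp : (Function.support fun n : Fin 3 → ℤ => ENNReal.ofReal (‖n‖ ^ (2 * s) *
      ‖UnitAddTorus.mFourierCoeff (w i) n‖ ^ 2)) ⊆ {n | n ≠ 0} := by
    intro n hn h0
    refine hn ?_
    simp [h0, Real.zero_rpow (by positivity : 2 * s ≠ 0)]
  rw [sobolevNorm_sq, one_pow, ENNReal.ofReal_one, one_mul,
    ← tsum_subtype_eq_of_support_subset hsupp]
  refine ENNReal.tsum_le_tsum fun n => ENNReal.ofReal_le_ofReal ?_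
  have h1 := norm_le_norm_waveVector_one n
  have h2 : ‖UnitAddTorus.mFourierCoeff (w i) n‖ ≤ ‖coeff w n‖ :=
    PiLp.norm_apply_le (coeff w n) i
  gcongr

/-- The factor `9 = 3²` is the triangle inequality over three components; only finiteness matters
here. -/
theorem lebesgueNorm_sq_le {s : ℝ} (hs0 : 0 < s) (hs1 : s ≤ 1) {w : Field} (hw : coeff w 0 = 0) :
    lebesgueNorm 1 (ENNReal.ofReal (6 / (3 - 2 * s))) w ^ 2 ≤
      9 * ENNReal.ofReal (scalarConst (6 / (3 - 2 * s))) * sobolevNorm 1 s w ^ 2 := by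
  have hr : 0 < 3 - 2 * s := by linarith
  set q := 6 / (3 - 2 * s) with hq
  have hq1 : 1 ≤ q := by rw [hq, le_div_iff₀ hr]; linarith
  set Y := ENNReal.ofReal (scalarConst q) * sobolevNorm 1 s w ^ 2 with hY
  have hcomp : ∀ i, eLpNorm (w i) (ENNReal.ofReal q) haar ≤ Y ^ (1 / 2 : ℝ) := fun i => by
    have h0 : UnitAddTorus.mFourierCoeff (w i) 0 = 0 :=
      congrArg (fun v : EuclideanSpace ℂ (Fin 3) => v i) hw
    have h1 := (eLpNorm_sq_le hs0 hs1 hq (w i) h0).trans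
      (mul_le_mul_right (tsum_component_le hs0 w i) _)
    have h2 := ENNReal.rpow_le_rpow h1 (by norm_num : (0 : ℝ) ≤ 1 / 2)
    rwa [← ENNReal.rpow_natCast, ← ENNReal.rpow_mul, Nat.cast_ofNat,
      mul_one_div_cancel two_ne_zero, ENNReal.rpow_one] at h2
  have hsum : lebesgueNorm 1 (ENNReal.ofReal q) w ≤ 3 * Y ^ (1 / 2 : ℝ) := by
    rw [lebesgueNorm, boxMeasure_one]
    calc _ ≤ eLpNorm (∑ i, fun y => ‖w i y‖) (ENNReal.ofReal q) haar := by
          refine eLpNorm_mono_real fun y => ?_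
          rw [EuclideanSpace.norm_eq, Finset.sum_apply]
          refine Real.sqrt_le_iff.2 ⟨Finset.sum_nonneg fun i _ => norm_nonneg _, ?_⟩
          exact Finset.sum_sq_le_sq_sum_of_nonneg fun i _ => norm_nonneg _
      _ ≤ ∑ i, eLpNorm (fun y => ‖w i y‖) (ENNReal.ofReal q) haar :=
          eLpNorm_sum_le (fun i _ => (Lp.aestronglyMeasurable (w i)).norm) (by simpa using hq1)
      _ ≤ ∑ _i : Fin 3, Y ^ (1 / 2 : ℝ) :=
          Finset.sum_le_sum fun i _ => by rw [eLpNorm_norm]; exact hcomp i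
      _ = 3 * Y ^ (1 / 2 : ℝ) := by simp
  calc _ ≤ (3 * Y ^ (1 / 2 : ℝ)) ^ 2 := by gcongr
    _ = 9 * Y := by
        rw [mul_pow, ← ENNReal.rpow_natCast (Y ^ (1 / 2 : ℝ)), ← ENNReal.rpow_mul]
        norm_num
    _ = _ := by rw [hY, mul_assoc]

theorem sobolevConst_one_lt_top {s : ℝ} (hs0 : 0 < s) (hs1 : s ≤ 1) : sobolevConst 1 s < ∞ :=
  lt_of_le_of_lt (b := 9 * ENNReal.ofReal (scalarConst (6 / (3 - 2 * s))))
    (sInf_le (Set.mem_ofPred_eq ▸ fun _ hw => lebesgueNorm_sq_le hs0 hs1 hw.1))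
    (ENNReal.mul_lt_top (by norm_num) ENNReal.ofReal_lt_top)

/-- The best Sobolev constant is attained as an upper bound. -/
theorem lebesgueNorm_sq_le_sobolevConst {L s : ℝ} (hL : 0 < L) (hs0 : 0 < s) (hs1 : s ≤ 1)
    {w : Field} (hw : w ∈ sobolevSpace L s) :
    lebesgueNorm L (ENNReal.ofReal (6 / (3 - 2 * s))) w ^ 2 ≤
      sobolevConst L s * sobolevNorm L s w ^ 2 := by
  have htop : sobolevNorm L s w ^ 2 ≠ ∞ := ENNReal.pow_ne_top hw.2.ne
  -- Division by the norm passes to the infimum unless the norm vanishes; then a single admissible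
  -- constant already forces the left side to vanish.
  rcases eq_or_ne (sobolevNorm L s w ^ 2) 0 with hzero | hzero
  · have hlt : sobolevConst L s < ∞ := by
      rw [sobolevConst_eq_one hL hs1]; exact sobolevConst_one_lt_top hs0 hs1
    obtain ⟨S, hS, -⟩ := sInf_lt_iff.1 hlt
    have := hS w hw
    rwa [hzero, mul_zero] at this ⊢
  · rw [← ENNReal.div_le_iff hzero htop]
    exact le_sInf fun S hS => (ENNReal.div_le_iff hzero htop).2 (hS w hw)

/-- A field with a single Fourier mode. -/
def planeWave : Field := fun _ => UnitAddTorus.mFourierLp 2 (fun _ => 1)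

theorem coeff_planeWave (n : Fin 3 → ℤ) (i : Fin 3) :
    coeff planeWave n i = if n = fun _ => 1 then 1 else 0 := by
  simp only [coeff, planeWave]
  rw [mFourierCoeff_eq_repr, HilbertBasis.repr_apply_apply, UnitAddTorus.coe_mFourierBasis]
  exact orthonormal_iff_ite.1 (UnitAddTorus.orthonormal_mFourier (d := Fin 3)) n _

theorem planeWave_mem_sobolevSpace (s : ℝ) : planeWave ∈ sobolevSpace 1 s := by
  have hne : (fun _ => 1 : Fin 3 → ℤ) ≠ 0 := fun h => by simpa using congrFun h 0
  refine ⟨by ext i; rw [coeff_planeWave, if_neg hne.symm]; rfl, ?_⟩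
  rw [sobolevNorm, tsum_eq_single ⟨fun _ => 1, hne⟩]
  · exact ENNReal.rpow_lt_top_of_nonneg (by norm_num)
      (ENNReal.mul_lt_top ENNReal.ofReal_lt_top ENNReal.ofReal_lt_top).ne
  · intro n hn
    have h1 : (n : Fin 3 → ℤ) ≠ fun _ => 1 := fun h => hn (Subtype.ext h)
    have h2 : coeff planeWave n = 0 := by
      ext i; rw [coeff_planeWave, if_neg h1]; rfl
    simp [h2]

theorem lebesgueNorm_planeWave_ne_zero {q : ℝ≥0∞} (hq : q ≠ 0) :
    lebesgueNorm 1 q planeWave ≠ 0 := by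
  intro h
  rw [lebesgueNorm, boxMeasure_one,
    eLpNorm_eq_zero_iff (aestronglyMeasurable_field _ _ Measure.AbsolutelyContinuous.rfl) hq] at h
  have h0 : planeWave 0 = 0 := by
    rw [Lp.eq_zero_iff_ae_eq_zero]
    filter_upwards [h] with y hy
    exact congrArg (fun v : EuclideanSpace ℂ (Fin 3) => v 0) hy
  have h1 := (UnitAddTorus.orthonormal_mFourier (d := Fin 3)).1 (fun _ => 1)
  have h2 : ‖planeWave 0‖ = 1 := h1
  rw [h0, norm_zero] at h2
  exact zero_ne_one h2

theorem sobolevConst_one_pos {s : ℝ} (hs0 : 0 < s) (hs1 : s ≤ 1) : 0 < sobolevConst 1 s := by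
  have hr : 0 < 3 - 2 * s := by linarith
  refine pos_iff_ne_zero.2 fun h => ?_
  have h1 := lebesgueNorm_sq_le_sobolevConst one_pos hs0 hs1 (planeWave_mem_sobolevSpace s)
  rw [h, zero_mul] at h1
  refine lebesgueNorm_planeWave_ne_zero (q := ENNReal.ofReal (6 / (3 - 2 * s))) ?_
    (pow_eq_zero_iff two_ne_zero |>.1 (le_zero_iff.1 h1))
  rw [Ne, ENNReal.ofReal_eq_zero, not_le]
  positivity

/-! ### The residual stress -/

/-- Weighted AM-GM: `x^(1-r) (1/r)^r ≤ (1-r) x + 1 ≤ 1 + x`. -/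
theorem div_one_add_le_rpow {x r : ℝ} (hx : 0 < x) (hr0 : 0 < r) (hr1 : r ≤ 1) :
    x / (1 + x) ≤ (r * x) ^ r := by
  have hAG := Real.geom_mean_le_arith_mean2_weighted (w₁ := 1 - r) (w₂ := r) (p₁ := x)
    (p₂ := r⁻¹) (by linarith) hr0.le hx.le (by positivity) (by ring)
  rw [mul_inv_cancel₀ hr0.ne', Real.inv_rpow hr0.le, Real.rpow_sub hx, Real.rpow_one,
    div_mul_eq_mul_div, div_le_iff₀ (by positivity), ← div_eq_mul_inv,
    div_le_iff₀ (by positivity)] at hAG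
  rw [div_le_iff₀ (by positivity), Real.mul_rpow hr0.le hx.le]
  refine hAG.trans ?_
  have : (1 - r) * x + 1 ≤ 1 + x := by nlinarith
  have hnn : 0 ≤ x ^ r * r ^ r := by positivity
  nlinarith

/-- The symbol `(1 - Ĝ)^{N+1}` of `I - D_N G`. -/
def defectSymbol (L α p : ℝ) (N : ℕ) (n : Fin 3 → ℤ) : ℝ :=
  (1 - helmholtzSymbol L α p n) ^ (N + 1)

theorem mFourierCoeff_filterOp (L p : ℝ) {α : ℝ} (hα : 0 < α) (f : Scalar) (n : Fin 3 → ℤ) :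
    UnitAddTorus.mFourierCoeff (filterOp L p hα f) n =
      helmholtzSymbol L α p n * UnitAddTorus.mFourierCoeff f n :=
  mFourierCoeff_multiplier _ _ _ _

theorem mFourierCoeff_one_sub_filterOp_pow (L p : ℝ) {α : ℝ} (hα : 0 < α) (j : ℕ) (f : Scalar)
    (n : Fin 3 → ℤ) :
    UnitAddTorus.mFourierCoeff (((1 - filterOp L p hα) ^ j) f) n =
      (1 - helmholtzSymbol L α p n : ℝ) ^ j * UnitAddTorus.mFourierCoeff f n := by
  induction j with
  | zero => simp
  | succ j ih =>
    rw [pow_succ', mul_apply_eq_comp, sub_apply,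
      one_apply_eq_self, mFourierCoeff_sub, mFourierCoeff_filterOp, ih]
    push_cast
    ring

/-- Geometric sum: `g ∑_{j ≤ N} (1-g)^j = 1 - (1-g)^(N+1)`. -/
theorem mFourierCoeff_deconvolution_filterOp (L p : ℝ) {α : ℝ} (hα : 0 < α) (N : ℕ) (f : Scalar)
    (n : Fin 3 → ℤ) :
    UnitAddTorus.mFourierCoeff (deconvolution L p hα N (filterOp L p hα f)) n =
      (1 - defectSymbol L α p N n : ℝ) * UnitAddTorus.mFourierCoeff f n := by
  unfold deconvolution defectSymbol
  induction N with
  | zero =>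
    rw [zero_add, Finset.sum_range_one, mFourierCoeff_one_sub_filterOp_pow, mFourierCoeff_filterOp]
    push_cast
    ring
  | succ N ih =>
    rw [Finset.sum_range_succ, add_apply, mFourierCoeff_add, ih,
      mFourierCoeff_one_sub_filterOp_pow, mFourierCoeff_filterOp]
    push_cast
    ring

theorem defectSymbol_eq {L α p : ℝ} {n : Fin 3 → ℤ} (hα : 0 < α) (hn : n ≠ 0) (N : ℕ) :
    defectSymbol L α p N n = ((α * ‖waveVector L n‖) ^ (2 * p) /
      (1 + (α * ‖waveVector L n‖) ^ (2 * p))) ^ (N + 1) := by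
  rw [defectSymbol, helmholtzSymbol, if_neg hn, ← Real.mul_rpow hα.le (norm_nonneg _)]
  have : 0 < 1 + (α * ‖waveVector L n‖) ^ (2 * p) := by positivity
  congr 1
  field_simp
  ring

theorem defectSymbol_nonneg {L α p : ℝ} {n : Fin 3 → ℤ} (hα : 0 < α) (hn : n ≠ 0) (N : ℕ) :
    0 ≤ defectSymbol L α p N n := by
  rw [defectSymbol_eq hα hn]
  positivity

theorem defectSymbol_le_one {L α p : ℝ} {n : Fin 3 → ℤ} (hα : 0 < α) (hn : n ≠ 0) (N : ℕ) :
    defectSymbol L α p N n ≤ 1 := by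
  rw [defectSymbol_eq hα hn]
  have : 0 ≤ (α * ‖waveVector L n‖) ^ (2 * p) := by positivity
  exact pow_le_one₀ (by positivity) (div_le_one_of_le₀ (by linarith) (by linarith))

theorem defectSymbol_le {L α p : ℝ} {n : Fin 3 → ℤ} (hL : 0 < L) (hα : 0 < α) (hp : 3 / 4 ≤ p)
    (hn : n ≠ 0) (N : ℕ) :
    defectSymbol L α p N n ≤
      α / (2 * p * (N + 1)) ^ (1 / (2 * p)) * ‖waveVector L n‖ := by
  have hk := norm_waveVector_pos hL hn
  rw [defectSymbol_eq hα hn]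
  set k := ‖waveVector L n‖
  have hp0 : 0 < p := by linarith
  have hN : (1 : ℝ) ≤ N + 1 := by linarith [N.cast_nonneg (α := ℝ)]
  -- With this exponent the power `N + 1` of the AM-GM bound is `(r x)^(1/(2p))`, which is linear in
  -- `|k|` for `x = (α|k|)^(2p)`.
  set r : ℝ := 1 / (2 * p * (N + 1)) with hr
  have hr0 : 0 < r := by positivity
  have hr1 : r ≤ 1 := by
    rw [hr, div_le_one (by positivity)]
    nlinarith
  refine (pow_le_pow_left₀ (by positivity)
    (div_one_add_le_rpow (by positivity) hr0 hr1) (N + 1)).trans (le_of_eq ?_)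
  rw [← Real.rpow_natCast, ← Real.rpow_mul (by positivity)]
  have e : r * ((N + 1 : ℕ) : ℝ) = 1 / (2 * p) := by
    rw [hr]; push_cast; field_simp
  rw [e, Real.mul_rpow hr0.le (by positivity), ← Real.rpow_mul (by positivity),
    mul_one_div_cancel (by positivity), Real.rpow_one, hr,
    Real.div_rpow one_pos.le (by positivity), Real.one_rpow]
  ring

theorem norm_coeff_of_symbol {u w : Field} {n : Fin 3 → ℤ} {m : ℝ}
    (h : ∀ i, UnitAddTorus.mFourierCoeff (w i) n = m * UnitAddTorus.mFourierCoeff (u i) n) :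
    ‖coeff w n‖ ^ 2 = m ^ 2 * ‖coeff u n‖ ^ 2 := by
  have : coeff w n = (m : ℂ) • coeff u n := by
    ext i
    exact h i
  rw [this, norm_smul, mul_pow, Complex.norm_real, Real.norm_eq_abs, sq_abs]

/-- The mean of a field and its deconvolved filtered part, and the defect, have energies that
balance: this is what gives the constant `2` of the stress bound for every `p`. -/
theorem sobolevNorm_mean_add_defect_le {L α p : ℝ} (hL : 0 < L) (hα : 0 < α) (hp : 3 / 4 ≤ p)
    (N : ℕ) {u a w : Field}
    (ha : ∀ n i, UnitAddTorus.mFourierCoeff (a i) n =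
      (1 - defectSymbol L α p N n / 2 : ℝ) * UnitAddTorus.mFourierCoeff (u i) n)
    (hw : ∀ n i, UnitAddTorus.mFourierCoeff (w i) n =
      (defectSymbol L α p N n : ℝ) * UnitAddTorus.mFourierCoeff (u i) n) :
    sobolevNorm L 1 a ^ 2 +
        ENNReal.ofReal (α / (2 * p * (N + 1)) ^ (1 / (2 * p)))⁻¹ * sobolevNorm L (1 / 2) w ^ 2 ≤
      ENNReal.ofReal (5 / 4) * sobolevNorm L 1 u ^ 2 := by
  have hp0 : 0 < p := by linarith
  set K := α / (2 * p * (N + 1)) ^ (1 / (2 * p)) with hK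
  have hK0 : 0 < K := by positivity
  simp only [sobolevNorm_sq]
  rw [mul_left_comm, mul_left_comm (ENNReal.ofReal (5 / 4)), ← mul_add,
    ← ENNReal.tsum_mul_left, ← ENNReal.tsum_mul_left, ← ENNReal.tsum_add]
  gcongr ENNReal.ofReal (L ^ 3) * ?_
  refine ENNReal.tsum_le_tsum fun n => ?_
  rw [← ENNReal.ofReal_mul (by positivity), ← ENNReal.ofReal_mul (by positivity),
    ← ENNReal.ofReal_add (by positivity) (by positivity)]
  refine ENNReal.ofReal_le_ofReal ?_
  rw [norm_coeff_of_symbol (ha n), norm_coeff_of_symbol (hw n)]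
  have hk := norm_waveVector_pos hL n.2
  have h0 := defectSymbol_nonneg (L := L) (p := p) hα n.2 N
  have h1 := defectSymbol_le_one (L := L) (p := p) hα n.2 N
  have h2 := defectSymbol_le hL hα hp n.2 N
  rw [← hK] at h2
  set θ := defectSymbol L α p N n
  set k := ‖waveVector L n‖
  have e1 : k ^ (2 * (1 : ℝ)) = k ^ 2 := by rw [mul_one, Real.rpow_ofNat]
  have e2 : k ^ (2 * (1 / 2 : ℝ)) = k := by norm_num
  rw [e1, e2]
  have h3 : K⁻¹ * θ ≤ k := by rwa [inv_mul_le_iff₀ hK0]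
  have h4 : K⁻¹ * θ * (k * θ) ≤ k * (k * θ) := by gcongr
  have h5 : 0 ≤ k ^ 2 * (1 - θ ^ 2) := by
    have : θ ^ 2 ≤ 1 := pow_le_one₀ h0 h1
    exact mul_nonneg (by positivity) (by linarith)
  -- By `K⁻¹θ ≤ k` the left side is at most `k² ((1 - θ/2)² + θ) = k² (1 + θ²/4)`: the terms linear
  -- in `θ` cancel.
  have h6 : k ^ 2 * (1 - θ / 2) ^ 2 + K⁻¹ * (k * θ ^ 2) ≤ 5 / 4 * k ^ 2 := by nlinarith
  have h7 := mul_le_mul_of_nonneg_right h6 (sq_nonneg ‖coeff u n‖)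
  nlinarith

/-- The symmetrised tensor product `a ⊗ b + b ⊗ a`. -/
def symTensor (a b : EuclideanSpace ℂ (Fin 3)) : EuclideanSpace ℂ (Fin 3 × Fin 3) :=
  WithLp.toLp 2 fun ij => a ij.1 * b ij.2 + b ij.1 * a ij.2

theorem norm_tensor (a b : EuclideanSpace ℂ (Fin 3)) :
    ‖(WithLp.toLp 2 fun ij => a ij.1 * b ij.2 : EuclideanSpace ℂ (Fin 3 × Fin 3))‖ =
      ‖a‖ * ‖b‖ := by
  rw [EuclideanSpace.norm_eq, EuclideanSpace.norm_eq, EuclideanSpace.norm_eq,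
    ← Real.sqrt_mul (Finset.sum_nonneg fun _ _ => by positivity), Fintype.sum_prod_type,
    Finset.sum_mul_sum]
  simp only [norm_mul, mul_pow]

theorem norm_symTensor_le (a b : EuclideanSpace ℂ (Fin 3)) :
    ‖symTensor a b‖ ≤ 2 * ‖a‖ * ‖b‖ := by
  have h : symTensor a b =
      (WithLp.toLp 2 fun ij => a ij.1 * b ij.2 : EuclideanSpace ℂ (Fin 3 × Fin 3)) +
      (WithLp.toLp 2 fun ij => b ij.1 * a ij.2 : EuclideanSpace ℂ (Fin 3 × Fin 3)) := rfl
  rw [h]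
  refine (norm_add_le _ _).trans (le_of_eq ?_)
  rw [norm_tensor, norm_tensor]
  ring

theorem eLpNorm_residualStress_le (L p : ℝ) {α : ℝ} (hα : 0 < α) (N : ℕ) (u a w : Field)
    (ha : ∀ i, a i = (1 / 2 : ℂ) • (u i + deconvolution L p hα N (filterOp L p hα (u i))))
    (hw : ∀ i, w i = u i - deconvolution L p hα N (filterOp L p hα (u i))) :
    eLpNorm (residualStress L p hα N u) 2 (boxMeasure L) ≤
      2 * lebesgueNorm L 6 a * lebesgueNorm L 3 w := by
  have hac := boxMeasure_absolutelyContinuous L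
  have hae : residualStress L p hα N u =ᵐ[boxMeasure L] fun y =>
      symTensor (WithLp.toLp 2 fun i => a i y) (WithLp.toLp 2 fun i => w i y) := by
    refine hac.ae_le ?_
    have h1 : ∀ i, ∀ᵐ y ∂haar, a i y =
        (1 / 2 : ℂ) * (u i y + deconvolution L p hα N (filterOp L p hα (u i)) y) := fun i => by
      rw [ha]
      filter_upwards [Lp.coeFn_smul (1 / 2 : ℂ)
        (u i + deconvolution L p hα N (filterOp L p hα (u i))),
        Lp.coeFn_add (u i) (deconvolution L p hα N (filterOp L p hα (u i)))] with y h1 h2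
      rw [h1, Pi.smul_apply, h2, Pi.add_apply, smul_eq_mul]
    have h2 : ∀ i, ∀ᵐ y ∂haar, w i y =
        u i y - deconvolution L p hα N (filterOp L p hα (u i)) y := fun i => by
      rw [hw]
      filter_upwards [Lp.coeFn_sub (u i)
        (deconvolution L p hα N (filterOp L p hα (u i)))] with y h1
      rw [h1, Pi.sub_apply]
    filter_upwards [ae_all_iff.2 h1, ae_all_iff.2 h2] with y h1 h2
    ext ij
    simp only [residualStress, symTensor, h1, h2]
    ring
  rw [eLpNorm_congr_ae hae]
  have : ENNReal.HolderTriple 6 3 2 := ⟨by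
    rw [← ENNReal.toReal_eq_toReal_iff' (by simp) (by simp), ENNReal.toReal_add (by simp) (by simp)]
    norm_num [ENNReal.toReal_inv]⟩
  exact eLpNorm_le_eLpNorm_mul_eLpNorm'_of_norm (p := 6) (q := 3) (r := 2)
    (aestronglyMeasurable_field a _ hac) (aestronglyMeasurable_field w _ hac) symTensor 2
    (.of_forall fun y => norm_symTensor_le _ _)

theorem eLpNorm_residualStress_sq_le {L α p : ℝ} (hL : 0 < L) (hα : 0 < α) (hp : 3 / 4 ≤ p)
    (N : ℕ) {u : Field} (hu : coeff u 0 = 0) {S₁ S₂ : ℝ} (hS₁ : 0 < S₁) (hS₂ : 0 < S₂)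
    (h₁ : sobolevConst L 1 = ENNReal.ofReal S₁) (h₂ : sobolevConst L (1 / 2) = ENNReal.ofReal S₂) :
    eLpNorm (residualStress L p hα N u) 2 (boxMeasure L) ^ 2 ≤
      ENNReal.ofReal (2 * (S₁ * S₂) * α / (2 * p * (N + 1)) ^ (1 / (2 * p))) *
        sobolevNorm L 1 u ^ 4 := by
  have hp0 : 0 < p := by linarith
  rcases eq_or_ne (sobolevNorm L 1 u) ∞ with htop | htop
  -- The prefactor is nonzero, so the right side really is `∞`.
  · rw [htop, ENNReal.top_pow four_ne_zero, ENNReal.mul_top]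
    · exact le_top
    · rw [Ne, ENNReal.ofReal_eq_zero, not_le]; positivity
  set a : Field := fun i =>
    (1 / 2 : ℂ) • (u i + deconvolution L p hα N (filterOp L p hα (u i))) with ha
  set w : Field := fun i => u i - deconvolution L p hα N (filterOp L p hα (u i)) with hw
  have hac : ∀ n i, UnitAddTorus.mFourierCoeff (a i) n =
      (1 - defectSymbol L α p N n / 2 : ℝ) * UnitAddTorus.mFourierCoeff (u i) n := fun n i => by
    rw [ha, mFourierCoeff_smul, mFourierCoeff_add, mFourierCoeff_deconvolution_filterOp]
    push_cast
    ring
  have hwc : ∀ n i, UnitAddTorus.mFourierCoeff (w i) n =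
      (defectSymbol L α p N n : ℝ) * UnitAddTorus.mFourierCoeff (u i) n := fun n i => by
    rw [hw, mFourierCoeff_sub, mFourierCoeff_deconvolution_filterOp]
    push_cast
    ring
  have hu0 : ∀ i, UnitAddTorus.mFourierCoeff (u i) 0 = 0 := fun i =>
    congrArg (fun v : EuclideanSpace ℂ (Fin 3) => v i) hu
  have ha0 : coeff a 0 = 0 := by
    ext i
    exact (hac 0 i).trans (by rw [hu0, mul_zero]; rfl)
  have hw0 : coeff w 0 = 0 := by
    ext i
    exact (hwc 0 i).trans (by rw [hu0, mul_zero]; rfl)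
  have hkey := sobolevNorm_mean_add_defect_le hL hα hp N hac hwc
  set K := α / (2 * p * (N + 1)) ^ (1 / (2 * p)) with hK
  have hK0 : 0 < K := by positivity
  have hKi : ENNReal.ofReal K⁻¹ ≠ 0 := by
    rw [Ne, ENNReal.ofReal_eq_zero, not_le]; positivity
  have hEtop : sobolevNorm L 1 u ^ 2 ≠ ∞ := ENNReal.pow_ne_top htop
  have hRtop : ENNReal.ofReal (5 / 4) * sobolevNorm L 1 u ^ 2 < ∞ :=
    ENNReal.mul_lt_top ENNReal.ofReal_lt_top hEtop.lt_top
  -- The balance also supplies the finiteness that places `a` and `w` in their Sobolev spaces.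
  have hsum := ENNReal.add_lt_top.1 (hkey.trans_lt hRtop)
  have hAtop : sobolevNorm L 1 a ^ 2 ≠ ∞ := hsum.1.ne
  have hBtop : sobolevNorm L (1 / 2) w ^ 2 ≠ ∞ :=
    fun h => hsum.2.ne (by rw [h, ENNReal.mul_top hKi])
  have hsa : a ∈ sobolevSpace L 1 :=
    ⟨ha0, lt_top_iff_ne_top.2 fun h => hAtop (by simp [h])⟩
  have hsw : w ∈ sobolevSpace L (1 / 2) :=
    ⟨hw0, lt_top_iff_ne_top.2 fun h => hBtop (by rw [h]; simp)⟩
  have hSa := lebesgueNorm_sq_le_sobolevConst hL one_pos le_rfl hsa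
  have hSw := lebesgueNorm_sq_le_sobolevConst hL one_half_pos (by norm_num) hsw
  rw [h₁, show (6 / (3 - 2 * 1) : ℝ) = 6 by norm_num, ENNReal.ofReal_ofNat] at hSa
  rw [h₂, show (6 / (3 - 2 * (1 / 2)) : ℝ) = 3 by norm_num, ENNReal.ofReal_ofNat] at hSw
  obtain ⟨A, hA0, hA⟩ : ∃ A : ℝ, 0 ≤ A ∧ sobolevNorm L 1 a ^ 2 = ENNReal.ofReal A :=
    ⟨_, ENNReal.toReal_nonneg, (ENNReal.ofReal_toReal hAtop).symm⟩
  obtain ⟨B, hB0, hB⟩ : ∃ B : ℝ, 0 ≤ B ∧ sobolevNorm L (1 / 2) w ^ 2 = ENNReal.ofReal B :=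
    ⟨_, ENNReal.toReal_nonneg, (ENNReal.ofReal_toReal hBtop).symm⟩
  obtain ⟨E, hE0, hE⟩ : ∃ E : ℝ, 0 ≤ E ∧ sobolevNorm L 1 u ^ 2 = ENNReal.ofReal E :=
    ⟨_, ENNReal.toReal_nonneg, (ENNReal.ofReal_toReal hEtop).symm⟩
  rw [hA, hB, hE, ← ENNReal.ofReal_mul (by positivity), ← ENNReal.ofReal_mul (by positivity),
    ← ENNReal.ofReal_add hA0 (by positivity), ENNReal.ofReal_le_ofReal_iff (by positivity)] at hkey
  -- From `4 A (K⁻¹B) ≤ (A + K⁻¹B)² ≤ (5E/4)²`.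
  have hprod : A * B ≤ K * (25 / 64) * E ^ 2 := by
    have h1 : A * (K⁻¹ * B) ≤ 25 / 64 * E ^ 2 := by
      have hBK : 0 ≤ K⁻¹ * B := by positivity
      nlinarith [sq_nonneg (A - K⁻¹ * B)]
    have h2 : A * B = K * (A * (K⁻¹ * B)) := by field_simp
    rw [h2, mul_assoc]
    gcongr
  calc eLpNorm (residualStress L p hα N u) 2 (boxMeasure L) ^ 2
      ≤ (2 * lebesgueNorm L 6 a * lebesgueNorm L 3 w) ^ 2 := by
        gcongr
        exact eLpNorm_residualStress_le L p hα N u a w (fun _ => rfl) fun _ => rfl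
    _ = 4 * lebesgueNorm L 6 a ^ 2 * lebesgueNorm L 3 w ^ 2 := by ring
    _ ≤ 4 * (ENNReal.ofReal S₁ * ENNReal.ofReal A) * (ENNReal.ofReal S₂ * ENNReal.ofReal B) := by
        rw [hA] at hSa
        rw [hB] at hSw
        gcongr
    _ = ENNReal.ofReal (4 * (S₁ * A) * (S₂ * B)) := by
        rw [ENNReal.ofReal_mul (by positivity), ENNReal.ofReal_mul (by positivity),
          ENNReal.ofReal_mul hS₁.le, ENNReal.ofReal_mul hS₂.le, ENNReal.ofReal_ofNat]
    _ ≤ ENNReal.ofReal (2 * (S₁ * S₂) * K * E ^ 2) := by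
        refine ENNReal.ofReal_le_ofReal ?_
        have h1 : S₁ * S₂ * (A * B) ≤ S₁ * S₂ * (K * (25 / 64) * E ^ 2) := by gcongr
        have h2 : 0 ≤ S₁ * S₂ * (K * E ^ 2) := by positivity
        nlinarith
    _ = _ := by
        rw [ENNReal.ofReal_mul (by positivity), ENNReal.ofReal_pow hE0, ← hE, ← pow_mul,
          mul_div_assoc]

end ResidualStress

end

theorem corollary4p1 :
    ∃ S₁ S₂ : ℝ, 0 < S₁ ∧ 0 < S₂ ∧
      (∀ L : ℝ, 0 < L →
        ResidualStress.sobolevConst L 1 = ENNReal.ofReal S₁ ∧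
        ResidualStress.sobolevConst L (1 / 2) = ENNReal.ofReal S₂) ∧
      ∀ (L α p T : ℝ) (_ : 0 < L) (hα : 0 < α) (_ : 3 / 4 ≤ p) (N : ℕ)
        (u : ℝ → ResidualStress.Field),
        (∀ t ∈ Set.Icc 0 T, u t ∈ ResidualStress.solenoidalSpace L 0) →
        ∀ t ∈ Set.Icc 0 T,
          eLpNorm (ResidualStress.residualStress L p hα N (u t)) 2
              (ResidualStress.boxMeasure L) ^ 2 ≤
            ENNReal.ofReal (2 * (S₁ * S₂) * α / (2 * p * (N + 1)) ^ (1 / (2 * p))) *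
              ResidualStress.sobolevNorm L 1 (u t) ^ 4 := by
  -- The box of side `1` supplies the universal constants.
  have hconst : ∀ s : ℝ, 0 < s → s ≤ 1 → 0 < (ResidualStress.sobolevConst 1 s).toReal ∧
      ∀ L : ℝ, 0 < L → ResidualStress.sobolevConst L s =
        ENNReal.ofReal (ResidualStress.sobolevConst 1 s).toReal := fun s hs0 hs1 => by
    have hlt := ResidualStress.sobolevConst_one_lt_top hs0 hs1
    refine ⟨ENNReal.toReal_pos (ResidualStress.sobolevConst_one_pos hs0 hs1).ne' hlt.ne,
      fun L hL => ?_⟩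
    rw [ENNReal.ofReal_toReal hlt.ne, ResidualStress.sobolevConst_eq_one hL hs1]
  obtain ⟨hp₁, he₁⟩ := hconst 1 one_pos le_rfl
  obtain ⟨hp₂, he₂⟩ := hconst (1 / 2) one_half_pos (by norm_num)
  refine ⟨_, _, hp₁, hp₂, fun L hL => ⟨he₁ L hL, he₂ L hL⟩, ?_⟩
  intro L α p T hL hα hp N u hu t ht
  exact ResidualStress.eLpNorm_residualStress_sq_le hL hα hp N (hu t ht).1.1 hp₁ hp₂
    (he₁ L hL) (he₂ L hL)
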